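/- Let $X$ be a finite alphabet with $n=|X|\ge 2$ letters. A code is a finite sequence $C=(v_1,\ldots,v_m)$, $m\ge 1$, of words over $X$. It is uniquely decodable if, for all $l,l'\ge 1$ and all indices, $v_{i_1}v_{i_2}\cdots v_{i_l}=v_{j_1}v_{j_2}\cdots v_{j_{l'}}$ implies $l=l'$ and $i_k=j_k$ for all $1\le k\le l$. It has finite delay if there is a number $t$ such that, for every non-empty finite concatenation $u$ of code words, the first $t$ letters of $u$ (all of $u$, if it has fewer than $t$ letters) determine which code word begins $u$; that is, whenever $u=v_{i_1}\cdots v_{i_l}$ and $u'=v_{j_1}\cdots v_{j_{l'}}$ ($l,l'\ge 1$) have the same first $t$ letters, then $v_{i_1}=v_{j_1}$. For a finite sequence $L=(a_1,\ldots,a_m)$, $m\ge 1$, of natural numbers, let $UD_n(L)$ be the set of all uniquely decodable codes $C=(v_1,\ldots,v_m)$ over $X$ with $|v_i|=a_i$ for all $i$, and let $FD_n(L)\subseteq UD_n(L)$ be the subset of the codes with finite delay. Theorem. If the set $UD_n(L)$ is non-empty, then the following statements are equivalent: (i) $FD_n(L)=UD_n(L)$; (ii) the length $m$ of $L$ is not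 greater than $2$ or, after reordering the elements of $L$, we have $L=(a,a,\ldots,a,b)$, where $a\mid b$. -/

import Mathlib

/-- The word `v_{i₁} v_{i₂} ⋯ v_{iₗ}` spelled by the list of indices `[i₁, …, iₗ]`, for the code
`C = (v₁, …, v_m)`, that is a finite sequence of words over `X`. -/
def codeConcat {X : Type*} {m : ℕ} (C : Fin m → List X) (s : List (Fin m)) : List X :=
  (s.map C).flatten

/-- A code (a sequence of words) is uniquely decodable if two nonempty sequences of indices that
spell the same word are equal. -/
def IsUDCode {X : Type*} {m : ℕ} (C : Fin m → List X) : Prop :=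
  ∀ s s' : List (Fin m), s ≠ [] → s' ≠ [] → codeConcat C s = codeConcat C s' → s = s'

/-- There is a number `t` such that for every (nonempty) word factorizable into code words, its
first `t` letters (all its letters, if there are fewer than `t`) determine the code word that
begins it. -/
def HasFiniteDelay {X : Type*} {m : ℕ} (C : Fin m → List X) : Prop :=
  ∃ t : ℕ, ∀ (i j : Fin m) (s s' : List (Fin m)),
    (codeConcat C (i :: s)).take t = (codeConcat C (j :: s')).take t → C i = C j

/-- The set of uniquely decodable codes over the alphabet `X` with `L` as the sequence of code word
lengths. -/
def UDCodes (X : Type*) {m : ℕ} (L : Fin m → ℕ) : Set (Fin m → List X) :=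
  {C | IsUDCode C ∧ ∀ i, (C i).length = L i}

/-- The subset of `UDCodes X L` of all codes with finite delay. -/
def FDCodes (X : Type*) {m : ℕ} (L : Fin m → ℕ) : Set (Fin m → List X) :=
  {C | C ∈ UDCodes X L ∧ HasFiniteDelay C}

/-! Sufficiency: if products beginning with two different words `x`, `y` agree on `|x| + |y|`
letters, a Euclidean argument gives `xy = yx`, which unique decodability forbids; this settles `m ≤
2`. If all words but `C k` have length `a` and `a ∣ |C k|`, then `C k` is never a prefix of a
product that begins with another word (`IsUDCode.not_prefix_of_dvd`), so a bounded window suffices.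

Necessity, for `m ≥ 3`: choose three words such that two different products become the same infinite
word `P βββ…` when followed by a power of `β` that is a code word. The other words are added
greedily to give a suffix code (`exists_suffixFree_extension`). The room comes from the Kraft
inequality, which holds since some uniquely decodable code has these lengths. A suffix code is
uniquely decodable from the right, whatever its delay from the left. -/

/-! ### Commutation of two words -/

section TwoWords

theorem exists_flatten_pair_eq {X : Type*} (x z : List X) (l : List (List X))
    (hl : ∀ w ∈ l, w = x ∨ w = x ++ z) :
    ∃ l' : List (List X), (∀ w ∈ l', w = x ∨ w = z) ∧ l'.flatten = l.flatten := by
  induction l with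
  | nil => exact ⟨[], by simp, rfl⟩
  | cons w l ih =>
    obtain ⟨l', h1, h2⟩ := ih fun w hw => hl w (List.mem_cons_of_mem _ hw)
    rcases hl w List.mem_cons_self with h | h
    · refine ⟨x :: l', ?_, by simp [h, h2]⟩
      intro w hw
      rcases List.mem_cons.1 hw with h | h
      exacts [Or.inl h, h1 w h]
    · refine ⟨x :: z :: l', ?_, by simp [h, h2]⟩
      intro w hw
      simp only [List.mem_cons] at hw
      rcases hw with h | h | h
      exacts [Or.inl h, Or.inr h, h1 w h]

/-- Two words that begin products with a long enough common prefix commute. -/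
theorem append_comm_of_take_eq {X : Type*} (k : ℕ) : ∀ (x y : List X) (l l' : List (List X)),
    x.length + y.length = k → (∀ w ∈ l, w = x ∨ w = y) → (∀ w ∈ l', w = x ∨ w = y) →
    k ≤ (x ++ l.flatten).length → k ≤ (y ++ l'.flatten).length →
    (x ++ l.flatten).take k = (y ++ l'.flatten).take k → x ++ y = y ++ x := by
  induction k using Nat.strong_induction_on with
  | _ k ih =>
  have key : ∀ (x y : List X) (l l' : List (List X)), x.length ≤ y.length →
      x.length + y.length = k → (∀ w ∈ l, w = x ∨ w = y) → (∀ w ∈ l', w = x ∨ w = y) →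
      k ≤ (x ++ l.flatten).length → k ≤ (y ++ l'.flatten).length →
      (x ++ l.flatten).take k = (y ++ l'.flatten).take k → x ++ y = y ++ x := by
    intro x y l l' hxy hk hl hl' hu hu' htake
    rcases eq_or_ne x [] with rfl | hx
    · simp
    have hx0 : 0 < x.length := List.length_pos_iff.2 hx
    have hpx : x <+: (y ++ l'.flatten).take k := by
      rw [← htake, List.prefix_take_iff]
      exact ⟨List.prefix_append _ _, by omega⟩
    have hpy : y <+: (y ++ l'.flatten).take k := by
      rw [List.prefix_take_iff]
      exact ⟨List.prefix_append _ _, by omega⟩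
    -- Euclidean step: `y = x ++ z`. Products of `x`, `y` are products of `x`, `z`; cancelling the
    -- leading `x` leaves the same situation for `x`, `z` with bound `|x| + |z|`.
    obtain ⟨z, rfl⟩ := List.prefix_of_prefix_length_le hpx hpy hxy
    obtain ⟨l₂', h1', h2'⟩ := exists_flatten_pair_eq x z l' hl'
    have hne : l ≠ [] := by
      rintro rfl
      simp at hu hk
      omega
    obtain ⟨w, l₁, rfl⟩ := List.exists_cons_of_ne_nil hne
    obtain ⟨l₂, h1, h2⟩ := exists_flatten_pair_eq x z l₁
      fun w hw => hl w (List.mem_cons_of_mem _ hw)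
    obtain ⟨l₃, h3, h4⟩ : ∃ l₃ : List (List X), (∀ v ∈ l₃, v = x ∨ v = z) ∧
        x ++ l₃.flatten = (w :: l₁).flatten := by
      rcases hl w List.mem_cons_self with h | h
      · exact ⟨l₂, h1, by simp [h, h2]⟩
      · refine ⟨z :: l₂, ?_, by simp [h, h2]⟩
        intro v hv
        rcases List.mem_cons.1 hv with h | h
        exacts [Or.inr h, h1 v h]
    rw [← h4] at htake hu
    rw [← h2'] at htake hu'
    have hkx : k = x.length + (k - x.length) := by omega
    rw [hkx, List.append_assoc x z, List.take_length_add_append,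
      List.take_length_add_append] at htake
    have hc := List.append_cancel_left htake
    simp only [List.length_append] at hk hu hu'
    have := ih (k - x.length) (by omega) x z l₃ l₂' (by omega) h3 h1'
      (by simp only [List.length_append]; omega) (by simp only [List.length_append]; omega) hc
    exact (congrArg (x ++ ·) this).trans (List.append_assoc _ _ _).symm
  intro x y l l' hk hl hl' hu hu' htake
  rcases le_total x.length y.length with h | h
  · exact key x y l l' h hk hl hl' hu hu' htake
  · exact (key y x l' l h (by omega) (fun w hw => (hl' w hw).symm) (fun w hw => (hl w hw).symm)
      hu' hu htake.symm).symm

end TwoWords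

/-! ### Sufficient conditions for finite delay -/

section Delay

variable {X : Type*} {m : ℕ} {C : Fin m → List X}

theorem codeConcat_cons (i : Fin m) (s : List (Fin m)) :
    codeConcat C (i :: s) = C i ++ codeConcat C s := by
  simp [codeConcat]

theorem codeConcat_append (s s' : List (Fin m)) :
    codeConcat C (s ++ s') = codeConcat C s ++ codeConcat C s' := by
  simp [codeConcat]

theorem IsUDCode.injective (h : IsUDCode C) : Function.Injective C := by
  intro i j hij
  simpa using h [i] [j] (by simp) (by simp) (by simp [codeConcat, hij])

theorem IsUDCode.ne_nil (h : IsUDCode C) (i : Fin m) : C i ≠ [] := by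
  intro hi
  simpa using h [i] [i, i] (by simp) (by simp) (by simp [codeConcat, hi])

theorem le_length_of_take_eq_of_ne {u u' : List X} {t : ℕ} (h : u.take t = u'.take t)
    (hne : u ≠ u') : t ≤ u.length := by
  by_contra! hlt
  have h1 : u.take t = u := List.take_of_length_le hlt.le
  have h2 := congrArg List.length h
  simp only [List.length_take] at h2
  have h3 : u'.take t = u' := List.take_of_length_le (by omega)
  exact hne (by rw [← h1, h, h3])

theorem IsUDCode.codeConcat_cons_ne (h : IsUDCode C) {i j : Fin m} (hij : C i ≠ C j)
    (s s' : List (Fin m)) : codeConcat C (i :: s) ≠ codeConcat C (j :: s') := by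
  intro he
  have := h _ _ (by simp) (by simp) he
  simp only [List.cons.injEq] at this
  exact hij (by rw [this.1])

/-- A uniquely decodable code of at most two words has finite delay. -/
theorem IsUDCode.hasFiniteDelay_of_le_two (h : IsUDCode C) (hm : m ≤ 2) : HasFiniteDelay C := by
  have hall : ∀ i j : Fin m, i ≠ j → ∀ k, k = i ∨ k = j := by
    intro i j hij k
    rw [Fin.ext_iff, Fin.ext_iff]
    rw [Ne, Fin.ext_iff] at hij
    omega
  refine ⟨∑ i, (C i).length, fun i j s s' htake => ?_⟩
  by_contra hC
  have hij : i ≠ j := fun h => hC (by rw [h])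
  have huniv : (Finset.univ : Finset (Fin m)) = {i, j} := by
    ext k
    simpa using hall i j hij k
  rw [huniv, Finset.sum_pair hij] at htake
  have hne := h.codeConcat_cons_ne hC s s'
  have h1 := le_length_of_take_eq_of_ne htake hne
  have h2 := le_length_of_take_eq_of_ne htake.symm hne.symm
  rw [codeConcat_cons] at htake h1
  rw [codeConcat_cons] at htake h2
  have hmem : ∀ s : List (Fin m), ∀ w ∈ s.map C, w = C i ∨ w = C j := by
    intro s w hw
    obtain ⟨k, -, rfl⟩ := List.mem_map.1 hw
    rcases hall i j hij k with rfl | rfl <;> simp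
  have hcomm := append_comm_of_take_eq _ (C i) (C j) (s.map C) (s'.map C) rfl (hmem s) (hmem s')
    h1 h2 htake
  have := h [i, j] [j, i] (by simp) (by simp) (by simpa [codeConcat] using hcomm)
  exact hij (by simpa using (List.cons.inj this).1)

theorem exists_eq_codeConcat_of_prefix {a : ℕ} {P : Fin m → Prop}
    (hC : ∀ i, P i → (C i).length = a) (l : List (Fin m)) :
    ∀ p : List X, (∀ i ∈ l, P i) → p <+: codeConcat C l → a ∣ p.length →
      ∃ l' : List (Fin m), (∀ i ∈ l', P i) ∧ p = codeConcat C l' := by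
  induction l with
  | nil =>
    intro p _ hp _
    exact ⟨[], by simp, by simpa [codeConcat] using hp⟩
  | cons i l ih =>
    intro p hl hp hdvd
    rcases eq_or_ne p [] with rfl | hne
    · exact ⟨[], by simp, by simp [codeConcat]⟩
    have hi := hC i (hl i List.mem_cons_self)
    have hle : a ≤ p.length := Nat.le_of_dvd (List.length_pos_iff.2 hne) hdvd
    rw [codeConcat_cons] at hp
    obtain ⟨p', rfl⟩ := List.prefix_of_prefix_length_le (List.prefix_append _ _) hp (by omega)
    rw [List.prefix_append_right_inj] at hp
    rw [List.length_append, hi, Nat.dvd_add_right (dvd_refl a)] at hdvd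
    obtain ⟨l', h1, h2⟩ := ih p' (fun k hk => hl k (List.mem_cons_of_mem _ hk)) hp hdvd
    refine ⟨i :: l', ?_, by rw [codeConcat_cons, h2]⟩
    intro k hk
    rcases List.mem_cons.1 hk with rfl | hk
    exacts [hl _ List.mem_cons_self, h1 k hk]

theorem length_le_codeConcat_length (h : ∀ i, C i ≠ []) (l : List (Fin m)) :
    l.length ≤ (codeConcat C l).length := by
  induction l with
  | nil => simp
  | cons i l ih =>
    have := List.length_pos_iff.2 (h i)
    rw [codeConcat_cons, List.length_append, List.length_cons]
    omega

/-- By divisibility, `C k` as a prefix of a product of the other words would itself be such a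
product. So `k` occurs in `s`; let `u` be the nonempty product before its first occurrence. If a
product `p` of the other words is a prefix of `C k`, then `u p` and `C k` are both prefixes of the
whole product, hence `u p` is a prefix of `C k`. Iterating gives prefixes of `C k` of unbounded
length. -/
theorem IsUDCode.not_prefix_of_dvd (h : IsUDCode C) {a : ℕ} {k : Fin m}
    (hC : ∀ i, i ≠ k → (C i).length = a) (hdvd : a ∣ (C k).length) {i : Fin m} (hi : i ≠ k)
    (s : List (Fin m)) : ¬ C k <+: codeConcat C (i :: s) := by
  intro hp
  have hnot : ∀ l : List (Fin m), (∀ j ∈ l, j ≠ k) → ¬ C k <+: codeConcat C l := by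
    intro l hl hpl
    obtain ⟨l', h1, h2⟩ := exists_eq_codeConcat_of_prefix hC l (C k) hl hpl hdvd
    have hne : l' ≠ [] := by
      rintro rfl
      exact h.ne_nil k (by simpa [codeConcat] using h2)
    have := h [k] l' (by simp) hne (by rw [← h2]; simp [codeConcat])
    subst this
    simpa using h1 k
  have hk : k ∈ s := by
    by_contra hk
    refine hnot (i :: s) ?_ hp
    intro j hj
    rcases List.mem_cons.1 hj with rfl | hj
    exacts [hi, fun h => hk (h ▸ hj)]
  obtain ⟨s₁, s₂, rfl, hs₁⟩ := List.eq_append_cons_of_mem hk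
  have grow : ∀ N : ℕ, ∃ l : List (Fin m), (∀ j ∈ l, j ≠ k) ∧ codeConcat C l <+: C k ∧
      N ≤ l.length := by
    intro N
    induction N with
    | zero => exact ⟨[], by simp, by simp [codeConcat], by simp⟩
    | succ N ih =>
      obtain ⟨l, hl, hpl, hlen⟩ := ih
      have hmem : ∀ j ∈ i :: s₁ ++ l, j ≠ k := by
        intro j hj
        simp only [List.cons_append, List.mem_cons, List.mem_append] at hj
        rcases hj with rfl | hj | hj
        exacts [hi, fun h => hs₁ (h ▸ hj), hl j hj]
      have hpre : codeConcat C (i :: s₁ ++ l) <+: codeConcat C (i :: (s₁ ++ k :: s₂)) := by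
        rw [← List.cons_append, codeConcat_append, codeConcat_append, codeConcat_cons k,
          List.prefix_append_right_inj]
        exact hpl.trans (List.prefix_append _ _)
      rcases List.prefix_or_prefix_of_prefix hp hpre with h1 | h1
      · exact absurd h1 (hnot _ hmem)
      · exact ⟨_, hmem, h1, by simp; omega⟩
  obtain ⟨l, -, hpl, hlen⟩ := grow ((C k).length + 1)
  have h1 := length_le_codeConcat_length h.ne_nil l
  have h2 := hpl.length_le
  omega

/-- If all words but one have the same length, and it divides the length of the last one, then
unique decodability implies finite delay. -/
theorem IsUDCode.hasFiniteDelay_of_dvd (h : IsUDCode C) {a : ℕ} {k : Fin m}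
    (hC : ∀ i, i ≠ k → (C i).length = a) (hdvd : a ∣ (C k).length) : HasFiniteDelay C := by
  have key : ∀ (i : Fin m) (s s' : List (Fin m)), i ≠ k →
      (codeConcat C (i :: s)).take (a + (C k).length) =
        (codeConcat C (k :: s')).take (a + (C k).length) → False := by
    intro i s s' hi htake
    refine h.not_prefix_of_dvd hC hdvd hi s ?_
    have : C k <+: (codeConcat C (k :: s')).take (a + (C k).length) := by
      rw [List.prefix_take_iff, codeConcat_cons]
      exact ⟨List.prefix_append _ _, by omega⟩
    rw [← htake] at this
    exact this.trans (List.take_prefix _ _)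
  -- The window need only cover both `C k` and one word of length `a`; the sum is a convenient
  -- bound.
  refine ⟨a + (C k).length, fun i j s s' htake => ?_⟩
  rcases eq_or_ne i k with rfl | hi <;> rcases eq_or_ne j i with rfl | hij
  · rfl
  · exact (key j s' s hij htake.symm).elim
  · rfl
  rcases eq_or_ne j k with rfl | hj
  · exact (key i s s' hi htake).elim
  have h1 := congrArg (List.take a) htake
  rw [List.take_take, List.take_take, min_eq_left (by omega), codeConcat_cons, codeConcat_cons,
    List.take_append_of_le_length (hC i hi).ge, List.take_append_of_le_length (hC j hj).ge,
    List.take_of_length_le (hC i hi).le, List.take_of_length_le (hC j hj).le] at h1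
  exact h1

end Delay

/-! ### Kraft inequality and construction of suffix codes -/

section SuffixCodes

open InformationTheory in
theorem IsUDCode.kraft {X : Type*} [Fintype X] [Nonempty X] {m : ℕ} {C : Fin m → List X}
    (h : IsUDCode C) : ∑ i, (1 / (Fintype.card X : ℝ)) ^ (C i).length ≤ 1 := by
  classical
  have hlift : ∀ l : List (List X), (∀ w ∈ l, w ∈ Set.range C) →
      ∃ s : List (Fin m), s.map C = l := by
    intro l hl
    choose g hg using hl
    refine ⟨l.attach.map fun w => g w.1 w.2, ?_⟩
    rw [List.map_map]
    conv_rhs => rw [← List.attach_map_subtype_val l]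
    exact List.map_congr_left fun w _ => hg w.1 w.2
  have hud : UniquelyDecodable ((Finset.univ.image C : Finset (List X)) : Set (List X)) := by
    intro l l' hl hl' he
    obtain ⟨s, rfl⟩ := hlift l (by simpa using hl)
    obtain ⟨s', rfl⟩ := hlift l' (by simpa using hl')
    change codeConcat C s = codeConcat C s' at he
    have hnil : ∀ {s : List (Fin m)}, codeConcat C s = [] → s = [] := by
      intro s hs
      have := length_le_codeConcat_length h.ne_nil s
      rw [hs] at this
      exact List.length_eq_zero_iff.1 (Nat.le_zero.1 this)
    rcases eq_or_ne s [] with rfl | hs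
    · rw [hnil he.symm]
    rcases eq_or_ne s' [] with rfl | hs'
    · rw [hnil he]
    rw [h s s' hs hs' he]
  have := kraft_mcmillan_inequality hud
  rwa [Finset.sum_image fun i _ j _ hij => h.injective hij] at this

/-- Decoding runs from the right: the last words of two factorizations are suffixes of one word,
hence comparable, hence equal. -/
theorem isUDCode_of_suffixFree {X : Type*} {m : ℕ} {C : Fin m → List X}
    (hne : ∀ i, C i ≠ []) (hC : ∀ i j, C i <:+ C j → i = j) : IsUDCode C := by
  have key : ∀ s s' : List (Fin m), codeConcat C s = codeConcat C s' → s = s' := by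
    intro s
    induction s using List.reverseRecOn with
    | nil =>
      intro s' h
      have := length_le_codeConcat_length hne s'
      rw [← h] at this
      exact (List.length_eq_zero_iff.1 (Nat.le_zero.1 this)).symm
    | append_singleton s i ih =>
      intro s' h
      rcases List.eq_nil_or_concat s' with rfl | ⟨s', j, rfl⟩
      · have := length_le_codeConcat_length hne (s ++ [i])
        rw [h] at this
        simp [codeConcat] at this
      have hs : ∀ (s : List (Fin m)) i, codeConcat C (s ++ [i]) = codeConcat C s ++ C i := by
        simp [codeConcat]
      rw [List.concat_eq_append, hs, hs] at h
      have hij : i = j := by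
        rcases List.suffix_or_suffix_of_suffix (List.suffix_append (codeConcat C s) (C i))
          (h ▸ List.suffix_append (codeConcat C s') (C j)) with h1 | h1
        exacts [hC _ _ h1, (hC _ _ h1).symm]
      subst hij
      rw [ih s' (List.append_cancel_right h), List.concat_eq_append]
  exact fun s s' _ _ h => key s s' h

/-- A word of length `ℓ` that is incomparable, for the suffix order, with every word of a family
that is small enough. -/
theorem exists_word_not_suffix {X : Type*} [Fintype X] [Nonempty X] {m : ℕ} (L : Fin m → ℕ)
    (S : Finset (Fin m)) (f : Fin m → List X) (hf : ∀ i ∈ S, (f i).length = L i) (ℓ : ℕ)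
    (g : List X) (hg : ∀ j ∈ S, ℓ < L j → (f j).drop (L j - ℓ) = g)
    (hK : ∑ i ∈ S, (1 / (Fintype.card X : ℝ)) ^ L i + (1 / (Fintype.card X : ℝ)) ^ ℓ ≤ 1) :
    ∃ w : List X, w.length = ℓ ∧ ∀ j ∈ S, ¬ w <:+ f j ∧ ¬ f j <:+ w := by
  classical
  set n := Fintype.card X
  have hn0 : 0 < n := Fintype.card_pos
  have hnR : (0 : ℝ) < n := by exact_mod_cast hn0
  let words : ℕ → Finset (List X) := fun k =>
    (Finset.univ : Finset (List.Vector X k)).image fun v => v.1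
  have hmem : ∀ k w, w ∈ words k ↔ w.length = k := by
    intro k w
    simp only [words, Finset.mem_image, Finset.mem_univ, true_and]
    exact ⟨fun ⟨v, hv⟩ => hv ▸ v.2, fun h => ⟨⟨w, h⟩, rfl⟩⟩
  have hcard : ∀ k, (words k).card = n ^ k := by
    intro k
    exact (Finset.card_image_of_injective _ Subtype.val_injective).trans (card_vector k)
  let S₁ := S.filter fun j => L j ≤ ℓ
  let S₂ := S.filter fun j => ¬ L j ≤ ℓ
  -- `B₁` collects the words of length `ℓ` ending in some `f j`. The longer `f j` all exclude the
  -- same word `g`, so `B₂` costs at most one word.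
  let B₁ := S₁.biUnion fun j => (words (ℓ - L j)).image (· ++ f j)
  let B₂ : Finset (List X) := S₂.image fun _ => g
  have hB₁ : B₁.card ≤ ∑ j ∈ S₁, n ^ (ℓ - L j) := by
    refine Finset.card_biUnion_le.trans (Finset.sum_le_sum fun j _ => ?_)
    exact Finset.card_image_le.trans (hcard _).le
  have hsplit : ∑ i ∈ S, (1 / (n : ℝ)) ^ L i =
      ∑ i ∈ S₁, (1 / (n : ℝ)) ^ L i + ∑ i ∈ S₂, (1 / (n : ℝ)) ^ L i :=
    (Finset.sum_filter_add_sum_filter_not S _ _).symm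
  have hscale : (n : ℝ) ^ ℓ * ∑ i ∈ S₁, (1 / (n : ℝ)) ^ L i =
      ((∑ j ∈ S₁, n ^ (ℓ - L j) : ℕ) : ℝ) := by
    rw [Finset.mul_sum]
    push_cast
    refine Finset.sum_congr rfl fun j hj => ?_
    rw [pow_sub₀ _ hnR.ne' (Finset.mem_filter.1 hj).2, one_div, inv_pow]
  have hone : (n : ℝ) ^ ℓ * (1 / (n : ℝ)) ^ ℓ = 1 := by
    rw [← mul_pow, mul_one_div_cancel hnR.ne', one_pow]
  rw [hsplit] at hK
  have hK' := mul_le_mul_of_nonneg_left hK (pow_nonneg hnR.le ℓ)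
  rw [mul_add, mul_add, hscale, hone, mul_one] at hK'
  have hlt : (B₁ ∪ B₂).card < (words ℓ).card := by
    rw [hcard]
    refine (Finset.card_union_le _ _).trans_lt ?_
    -- The Kraft sum leaves one word beyond `B₁`. If `S₂` is nonempty, its positive contribution
    -- makes the inequality strict, which pays for `g`.
    rcases S₂.eq_empty_or_nonempty with h | h
    · have h0 : B₂.card = 0 := by simp [B₂, h]
      rw [h, Finset.sum_empty, mul_zero, add_zero] at hK'
      have : (∑ j ∈ S₁, n ^ (ℓ - L j)) + 1 ≤ n ^ ℓ := by exact_mod_cast hK'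
      omega
    · have h1 : B₂.card = 1 := by simp [B₂, Finset.image_const h]
      have hpos : 0 < (n : ℝ) ^ ℓ * ∑ i ∈ S₂, (1 / (n : ℝ)) ^ L i :=
        mul_pos (by positivity) (Finset.sum_pos (fun _ _ => by positivity) h)
      have : ((∑ j ∈ S₁, n ^ (ℓ - L j) : ℕ) : ℝ) + 1 < (n : ℝ) ^ ℓ := by linarith
      have : (∑ j ∈ S₁, n ^ (ℓ - L j)) + 1 < n ^ ℓ := by exact_mod_cast this
      omega
  obtain ⟨w, hw, hwB⟩ := Finset.exists_mem_notMem_of_card_lt_card hlt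
  rw [hmem] at hw
  have hdown : ∀ j ∈ S, ¬ f j <:+ w := by
    rintro j hj ⟨u, hu⟩
    have hlen := congrArg List.length hu
    rw [List.length_append, hf j hj, hw] at hlen
    refine hwB (Finset.mem_union_left _ (Finset.mem_biUnion.2 ⟨j, ?_, ?_⟩))
    · exact Finset.mem_filter.2 ⟨hj, by omega⟩
    · exact Finset.mem_image.2 ⟨u, (hmem _ _).2 (by omega), hu⟩
  refine ⟨w, hw, fun j hj => ⟨fun hs => ?_, hdown j hj⟩⟩
  have hle := hs.length_le
  rw [hw, hf j hj] at hle
  rcases hle.lt_or_eq with hlt | heq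
  · refine hwB (Finset.mem_union_right _ (Finset.mem_image.2 ⟨j, ?_, ?_⟩))
    · exact Finset.mem_filter.2 ⟨hj, by omega⟩
    · rw [List.suffix_iff_eq_drop, hf j hj, hw, hg j hj hlt] at hs
      exact hs.symm
  · rw [hs.eq_of_length (by rw [hw, hf j hj, heq])] at hdown
    exact hdown j hj List.suffix_rfl

/-- A partial suffix code whose long words agree on their ends extends to a suffix code with
prescribed lengths, provided these lengths satisfy the Kraft inequality. -/
theorem exists_suffixFree_extension {X : Type*} [Fintype X] [Nonempty X] {m : ℕ} (L : Fin m → ℕ)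
    (hK : ∑ i, (1 / (Fintype.card X : ℝ)) ^ L i ≤ 1) (g : ℕ → List X) (k : ℕ) :
    ∀ (S : Finset (Fin m)) (f : Fin m → List X), Sᶜ.card = k → (∀ i ∈ S, (f i).length = L i) →
      (∀ i ∈ S, ∀ j ∈ S, f i <:+ f j → i = j) →
      (∀ i ∉ S, ∀ j ∈ S, L i < L j → (f j).drop (L j - L i) = g (L i)) →
      ∃ C : Fin m → List X, (∀ i, (C i).length = L i) ∧ (∀ i ∈ S, C i = f i) ∧
        ∀ i j, C i <:+ C j → i = j := by
  classical
  induction k with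
  | zero =>
    intro S f hS hf hfree _
    have hS' : ∀ i, i ∈ S := by
      intro i
      by_contra hi
      rw [Finset.card_eq_zero] at hS
      have : i ∈ Sᶜ := Finset.mem_compl.2 hi
      simp [hS] at this
    exact ⟨f, fun i => hf i (hS' i), fun _ _ => rfl, fun i j => hfree i (hS' i) j (hS' j)⟩
  | succ k ih =>
    intro S f hS hf hfree hg
    have hne : Sᶜ.Nonempty := Finset.card_pos.1 (by omega)
    -- Filling shortest lengths first, the new word is never longer than a missing one, so the
    -- condition on common ends is vacuous for it.
    obtain ⟨i, hi, hmin⟩ := Finset.exists_min_image Sᶜ L hne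
    rw [Finset.mem_compl] at hi
    have hKS : ∑ j ∈ S, (1 / (Fintype.card X : ℝ)) ^ L j + (1 / (Fintype.card X : ℝ)) ^ L i
        ≤ 1 := by
      rw [add_comm]
      refine (Finset.sum_insert (f := fun j => (1 / (Fintype.card X : ℝ)) ^ L j)
        hi).symm.le.trans ?_
      exact (Finset.sum_le_sum_of_subset_of_nonneg (Finset.subset_univ _)
        fun _ _ _ => by positivity).trans hK
    obtain ⟨w, hw, hws⟩ := exists_word_not_suffix L S f hf (L i) (g (L i)) (hg i hi) hKS
    have hupd : ∀ j ∈ S, Function.update f i w j = f j := by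
      intro j hj
      refine Function.update_of_ne ?_ _ _
      rintro rfl
      exact hi hj
    have hcard : (insert i S)ᶜ.card = k := by
      rw [Finset.card_compl, Finset.card_insert_of_notMem hi]
      rw [Finset.card_compl] at hS
      omega
    have hlen : ∀ j ∈ insert i S, (Function.update f i w j).length = L j := by
      intro j hj
      rcases Finset.mem_insert.1 hj with rfl | hj
      · simpa using hw
      · rw [hupd j hj, hf j hj]
    have hfree' : ∀ j ∈ insert i S, ∀ j' ∈ insert i S,
        Function.update f i w j <:+ Function.update f i w j' → j = j' := by
      intro j hj j' hj' hs
      rcases Finset.mem_insert.1 hj with rfl | hS <;>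
        rcases Finset.mem_insert.1 hj' with rfl | hS'
      · rfl
      · rw [Function.update_self, hupd j' hS'] at hs
        exact ((hws j' hS').1 hs).elim
      · rw [Function.update_self, hupd j hS] at hs
        exact ((hws j hS).2 hs).elim
      · rw [hupd j hS, hupd j' hS'] at hs
        exact hfree j hS j' hS' hs
    obtain ⟨C, h1, h2, h3⟩ := ih (insert i S) (Function.update f i w) hcard hlen hfree'
      fun i' hi' j hj hlt => by
      rw [Finset.mem_insert, not_or] at hi'
      rcases Finset.mem_insert.1 hj with rfl | hj
      · have := hmin i' (Finset.mem_compl.2 hi'.2)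
        omega
      · rw [hupd j hj]
        exact hg i' hi'.2 j hj hlt
    exact ⟨C, h1, fun j hj => by rw [h2 j (Finset.mem_insert_of_mem hj), hupd j hj], h3⟩

end SuffixCodes

/-! ### Codes of infinite delay -/

section InfiniteDelay

variable {X : Type*} {m : ℕ}

theorem codeConcat_replicate_of_eq_replicate {C : Fin m → List X} {k : Fin m} {c : ℕ} {β : X}
    (hk : C k = List.replicate c β) (N : ℕ) :
    codeConcat C (List.replicate N k) = List.replicate (N * c) β := by
  simp [codeConcat, hk]

theorem not_hasFiniteDelay_of_common_tail {C : Fin m → List X} {i j k : Fin m} (hij : C i ≠ C j)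
    {c : ℕ} (hc : 0 < c) {β : X} (hk : C k = List.replicate c β) {s s' : List (Fin m)}
    {P : List X} {e e' : ℕ} (hs : codeConcat C (i :: s) = P ++ List.replicate e β)
    (hs' : codeConcat C (j :: s') = P ++ List.replicate e' β) : ¬ HasFiniteDelay C := by
  rintro ⟨t, ht⟩
  refine hij (ht i j (s ++ List.replicate t k) (s' ++ List.replicate t k) ?_)
  have h1 : t ≤ t * c := Nat.le_mul_of_pos_right t hc
  rw [← List.cons_append, ← List.cons_append, codeConcat_append, codeConcat_append, hs, hs',
    codeConcat_replicate_of_eq_replicate hk, List.append_assoc, List.append_assoc,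
    List.replicate_append_replicate, List.replicate_append_replicate, List.take_append,
    List.take_append, List.take_replicate, List.take_replicate, min_eq_left (by omega),
    min_eq_left (by omega)]

theorem exists_mem_UDCodes_of_three [Fintype X] [Nonempty X] {L : Fin m → ℕ}
    (hpos : ∀ i, 0 < L i) (hK : ∑ i, (1 / (Fintype.card X : ℝ)) ^ L i ≤ 1) {i j k : Fin m}
    (hij : i ≠ j) (hik : i ≠ k) (hjk : j ≠ k) {x y z : List X} (hx : x.length = L i)
    (hy : y.length = L j) (hz : z.length = L k) (hxy : ¬ x <:+ y) (hyx : ¬ y <:+ x)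
    (hxz : ¬ x <:+ z) (hzx : ¬ z <:+ x) (hyz : ¬ y <:+ z) (hzy : ¬ z <:+ y) (g : ℕ → List X)
    (hg : ∀ l, l ≠ i → l ≠ j → l ≠ k → (L l < L i → x.drop (L i - L l) = g (L l)) ∧
      (L l < L j → y.drop (L j - L l) = g (L l)) ∧ (L l < L k → z.drop (L k - L l) = g (L l))) :
    ∃ C ∈ UDCodes X L, C i = x ∧ C j = y ∧ C k = z := by
  classical
  let f : Fin m → List X := fun l => if l = i then x else if l = j then y else z
  have hfi : f i = x := if_pos rfl
  have hfj : f j = y := by simp [f, hij.symm]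
  have hfk : f k = z := by simp [f, hik.symm, hjk.symm]
  have hS : ∀ l, l ∈ ({i, j, k} : Finset (Fin m)) ↔ l = i ∨ l = j ∨ l = k := by simp
  obtain ⟨C, h1, h2, h3⟩ := exists_suffixFree_extension L hK g _ {i, j, k} f rfl
    (by
      intro l hl
      rcases (hS l).1 hl with rfl | rfl | rfl
      exacts [hfi ▸ hx, hfj ▸ hy, hfk ▸ hz])
    (by
      intro l hl l' hl' hs
      rcases (hS l).1 hl with rfl | rfl | rfl <;> rcases (hS l').1 hl' with rfl | rfl | rfl <;>
        simp only [hfi, hfj, hfk] at hs <;> first | rfl | contradiction)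
    (by
      intro l hl l' hl' hlt
      rw [hS, not_or, not_or] at hl
      obtain ⟨g1, g2, g3⟩ := hg l hl.1 hl.2.1 hl.2.2
      rcases (hS l').1 hl' with rfl | rfl | rfl
      exacts [hfi ▸ g1 hlt, hfj ▸ g2 hlt, hfk ▸ g3 hlt])
  refine ⟨C, ⟨isUDCode_of_suffixFree (fun l hl => ?_) h3, h1⟩, ?_, ?_, ?_⟩
  · have := hpos l
    rw [← h1, hl] at this
    simp at this
  · rw [h2 i (by simp), hfi]
  · rw [h2 j (by simp), hfj]
  · rw [h2 k (by simp), hfk]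

theorem cons_replicate_suffix_iff {α β : X} (hαβ : α ≠ β) {e e' : ℕ} :
    α :: List.replicate e β <:+ α :: List.replicate e' β ↔ e = e' := by
  refine ⟨fun h => ?_, fun h => h ▸ List.suffix_rfl⟩
  rcases List.suffix_cons_iff.1 h with h | h
  · simpa using congrArg List.length h
  · exact (hαβ (List.eq_of_mem_replicate (h.subset List.mem_cons_self))).elim

theorem drop_cons_replicate {α β : X} {a ℓ : ℕ} (h : ℓ < a) :
    (α :: List.replicate (a - 1) β).drop (a - ℓ) = List.replicate ℓ β := by
  obtain ⟨d, hd⟩ : ∃ d, a - ℓ = d + 1 := ⟨a - ℓ - 1, by omega⟩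
  rw [hd, List.drop_succ_cons, List.drop_replicate]
  congr 1
  omega

/-- If two of the lengths differ and a third one is at least as large, there is a code of infinite
delay. -/
theorem exists_not_hasFiniteDelay_of_ne [Fintype X] {α β : X} (hαβ : α ≠ β) {L : Fin m → ℕ}
    (hpos : ∀ i, 0 < L i) (hK : ∑ i, (1 / (Fintype.card X : ℝ)) ^ L i ≤ 1) {i j k : Fin m}
    (hik : i ≠ k) (hjk : j ≠ k) (hL : L i ≠ L j) (hLi : L i ≤ L k) (hLj : L j ≤ L k) :
    ∃ C ∈ UDCodes X L, ¬ HasFiniteDelay C := by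
  have : Nonempty X := ⟨α⟩
  have hi := hpos i
  have hj := hpos j
  have h1 : ∀ e c : ℕ, ¬ α :: List.replicate e β <:+ List.replicate c β := fun e c h =>
    hαβ (List.eq_of_mem_replicate (h.subset List.mem_cons_self))
  have h2 : ∀ e c : ℕ, e < c → ¬ List.replicate c β <:+ α :: List.replicate e β := by
    intro e c hec h
    have := h.eq_of_length_le (by simpa using hec)
    exact h1 e c (this ▸ List.suffix_rfl)
  -- Both `C i` and `C j` have the form `αβ…β` and are continued by powers of `C k = β…β` to
  -- `αβββ…`. As `C k` is at least as long as they are, it is a suffix of neither.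
  obtain ⟨C, hC, hCi, hCj, hCk⟩ := exists_mem_UDCodes_of_three hpos hK
    (i := i) (j := j) (k := k) (fun h => hL (by rw [h])) hik hjk
    (x := α :: List.replicate (L i - 1) β) (y := α :: List.replicate (L j - 1) β)
    (z := List.replicate (L k) β) (by simp; omega) (by simp; omega) (by simp)
    (by rw [cons_replicate_suffix_iff hαβ]; omega) (by rw [cons_replicate_suffix_iff hαβ]; omega)
    (h1 _ _) (h2 _ _ (by omega)) (h1 _ _) (h2 _ _ (by omega)) (fun ℓ => List.replicate ℓ β)
    fun l _ _ _ => ⟨drop_cons_replicate, drop_cons_replicate, fun h => by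
      rw [List.drop_replicate]
      congr 1
      omega⟩
  refine ⟨C, hC, not_hasFiniteDelay_of_common_tail (i := i) (j := j) (s := []) (s' := [])
    (P := [α]) (e := L i - 1) (e' := L j - 1) ?_ (hpos k) hCk ?_ ?_⟩
  · intro h
    have := congrArg List.length h
    rw [hC.2, hC.2] at this
    exact hL this
  · simp [codeConcat, hCi]
  · simp [codeConcat, hCj]

/-- If all lengths but one equal `a`, and the last one is larger and not a multiple of `a`, there
is a code of infinite delay. -/
theorem exists_not_hasFiniteDelay_of_not_dvd [Fintype X] {α β : X} (hαβ : α ≠ β) {L : Fin m → ℕ}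
    (hpos : ∀ i, 0 < L i) (hK : ∑ i, (1 / (Fintype.card X : ℝ)) ^ L i ≤ 1) {i j k : Fin m}
    (hij : i ≠ j) (hik : i ≠ k) (hjk : j ≠ k) {a : ℕ} (hL : ∀ l, l ≠ k → L l = a)
    (hlt : a < L k) (hdvd : ¬ a ∣ L k) :
    ∃ C ∈ UDCodes X L, ¬ HasFiniteDelay C := by
  have : Nonempty X := ⟨α⟩
  have ha : 0 < a := hL i hik ▸ hpos i
  obtain ⟨r, hr⟩ : ∃ r, r = L k % a := ⟨_, rfl⟩
  obtain ⟨q, hq⟩ : ∃ q, q = L k / a := ⟨_, rfl⟩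
  have hra : r < a := hr ▸ Nat.mod_lt _ ha
  have hr0 : 0 < r := hr ▸ Nat.pos_of_ne_zero fun h => hdvd (Nat.dvd_of_mod_eq_zero h)
  have hqr : q * a + r = L k := by rw [hq, hr, mul_comm]; exact Nat.div_add_mod _ _
  -- With `x = α^r β^(a-r)` and `y = x^q α^r`, one has `x^(q+1) = y β^(a-r)`, so `x^(q+1)` and `y`
  -- have the same continuation by powers of `β^a`. Since `0 < r < a`, `y` ends in `α` and `x` in
  -- `β`.
  let x : List X := List.replicate r α ++ List.replicate (a - r) β
  let y : List X := (List.replicate q x).flatten ++ List.replicate r α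
  have hxl : x.length = a := by simp [x]; omega
  have hyl : y.length = L k := by simp [y, hxl, hqr]
  have hαx : α ∈ x := by simp [x]; omega
  have hend : ∀ u v : List X, u ++ [β] ≠ v ++ [α] := by
    intro u v h
    exact hαβ (by simpa using (List.append_inj' h rfl).2.symm)
  have hy_end : ∃ v, y = v ++ [α] := by
    refine ⟨(List.replicate q x).flatten ++ List.replicate (r - 1) α, ?_⟩
    rw [List.append_assoc, ← List.replicate_succ', Nat.sub_add_cancel hr0]
  have hx_end : ∃ u, x = u ++ [β] := by
    refine ⟨List.replicate r α ++ List.replicate (a - r - 1) β, ?_⟩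
    rw [List.append_assoc, ← List.replicate_succ', Nat.sub_add_cancel (by omega)]
  have hz_end : ∃ u, List.replicate a β = u ++ [β] := by
    refine ⟨List.replicate (a - 1) β, ?_⟩
    rw [← List.replicate_succ', Nat.sub_add_cancel ha]
  have hnot_suffix : ∀ w : List X, (∃ u, w = u ++ [β]) → ¬ w <:+ y := by
    rintro w ⟨u, rfl⟩ ⟨t, ht⟩
    obtain ⟨v, hv⟩ := hy_end
    rw [hv, ← List.append_assoc] at ht
    exact hend _ _ ht
  have hxz : x ≠ List.replicate a β := by
    intro h
    rw [h] at hαx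
    exact hαβ (List.eq_of_mem_replicate hαx)
  obtain ⟨C, hC, hCi, hCj, hCk⟩ := exists_mem_UDCodes_of_three hpos hK hij hik hjk
    (x := x) (y := List.replicate a β) (z := y) (by rw [hxl, hL i hik])
    (by rw [List.length_replicate, hL j hjk]) hyl
    (fun h => hxz (h.eq_of_length (by simp [hxl])))
    (fun h => hxz (h.eq_of_length (by simp [hxl])).symm)
    (hnot_suffix _ hx_end) (fun h => by have := h.length_le; omega) (hnot_suffix _ hz_end)
    (fun h => by have := h.length_le; rw [List.length_replicate] at this; omega)
    -- All missing words have length `a`, so only `y` is longer than they are and its own ends serve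
    -- as `g`.
    (fun ℓ => y.drop (L k - ℓ))
    fun l _ _ hl => ⟨fun h => by rw [hL l hl, hL i hik] at h; omega,
      fun h => by rw [hL l hl, hL j hjk] at h; omega, fun _ => rfl⟩
  refine ⟨C, hC, not_hasFiniteDelay_of_common_tail (i := i) (j := k) (s := List.replicate q i)
    (s' := []) (P := y) (e := a - r) (e' := 0) ?_ ha hCj ?_ ?_⟩
  · intro h
    have := congrArg List.length h
    rw [hC.2, hC.2, hL i hik] at this
    omega
  · rw [← List.replicate_succ, List.replicate_succ', codeConcat_append]
    simp [codeConcat, hCi, y, x]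
  · simp [codeConcat, hCk]

end InfiniteDelay

/-! ### Reordering of lengths and the equivalence -/

theorem ofFn_perm_replicate_append_iff {m : ℕ} (L : Fin m → ℕ) (a b : ℕ) :
    (List.ofFn L).Perm (List.replicate (m - 1) a ++ [b]) ↔
      ∃ k, L k = b ∧ ∀ i, i ≠ k → L i = a := by
  classical
  have herase : ∀ k : Fin m, ((List.ofFn L : List ℕ) : Multiset ℕ) =
      L k ::ₘ (Finset.univ.erase k).val.map L := by
    intro k
    rw [← Multiset.map_cons L, ← Finset.insert_val_of_notMem (Finset.notMem_erase k _),
      Finset.insert_erase (Finset.mem_univ k), Fin.univ_val_map]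
  have hrep : ((List.replicate (m - 1) a ++ [b] : List ℕ) : Multiset ℕ) =
      b ::ₘ Multiset.replicate (m - 1) a := by
    rw [← Multiset.coe_add, Multiset.coe_replicate, Multiset.coe_singleton, add_comm,
      Multiset.singleton_add]
  have hcard : ∀ k : Fin m, Multiset.card ((Finset.univ.erase k).val.map L) = m - 1 := by
    intro k
    simp
  rw [← Multiset.coe_eq_coe, hrep]
  constructor
  · intro h
    have hb : b ∈ ((List.ofFn L : List ℕ) : Multiset ℕ) := h ▸ Multiset.mem_cons_self _ _
    obtain ⟨k, rfl⟩ := by simpa using hb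
    refine ⟨k, rfl, fun i hi => ?_⟩
    rw [herase k, Multiset.cons_inj_right, Multiset.eq_replicate] at h
    exact h.2 _ (Multiset.mem_map_of_mem L
      (Finset.mem_def.1 (Finset.mem_erase.2 ⟨hi, Finset.mem_univ i⟩)))
  · rintro ⟨k, rfl, h⟩
    rw [herase k, Multiset.cons_inj_right, Multiset.eq_replicate]
    refine ⟨hcard k, fun c hc => ?_⟩
    obtain ⟨i, hi, rfl⟩ := Multiset.mem_map.1 hc
    exact h i (Finset.mem_erase.1 (Finset.mem_def.2 hi)).1

theorem exists_mem_UDCodes_not_hasFiniteDelay {X : Type*} [Fintype X] (hX : 2 ≤ Fintype.card X)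
    {m : ℕ} (hm : 3 ≤ m) {L : Fin m → ℕ} (hL : (UDCodes X L).Nonempty)
    (h : ¬ ∃ (a : ℕ) (k : Fin m), a ∣ L k ∧ ∀ i, i ≠ k → L i = a) :
    ∃ C ∈ UDCodes X L, ¬ HasFiniteDelay C := by
  classical
  obtain ⟨α, β, hαβ⟩ := Fintype.exists_pair_of_one_lt_card hX
  have : Nonempty X := ⟨α⟩
  obtain ⟨C, hC⟩ := hL
  have hpos : ∀ i, 0 < L i := fun i => hC.2 i ▸ List.length_pos_iff.2 (hC.1.ne_nil i)
  have hK : ∑ i, (1 / (Fintype.card X : ℝ)) ^ L i ≤ 1 := by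
    have := hC.1.kraft
    simpa only [hC.2] using this
  have : Nonempty (Fin m) := ⟨⟨0, by omega⟩⟩
  -- Both constructions need `k` of maximal length; which one applies depends on whether the
  -- remaining lengths are all equal.
  obtain ⟨k, hk⟩ := Finite.exists_max L
  have hother : ∀ p : Fin m, ∃ j, j ≠ p ∧ j ≠ k := by
    intro p
    by_contra! hcon
    have h1 : (Finset.univ : Finset (Fin m)) ⊆ {p, k} := by
      intro j _
      by_cases hj : j = p
      · simp [hj]
      · simp [hcon j hj]
    have h2 := (Finset.card_le_card h1).trans Finset.card_le_two
    rw [Finset.card_univ, Fintype.card_fin] at h2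
    omega
  obtain ⟨i, hik, -⟩ := hother k
  obtain ⟨j, hji, hjk⟩ := hother i
  by_cases hall : ∀ l, l ≠ k → L l = L i
  · have hdvd : ¬ L i ∣ L k := fun hd => h ⟨_, k, hd, hall⟩
    have hne : L i ≠ L k := fun he => hdvd (he ▸ dvd_rfl)
    exact exists_not_hasFiniteDelay_of_not_dvd hαβ hpos hK hji.symm hik hjk hall
      (lt_of_le_of_ne (hk i) hne) hdvd
  · push Not at hall
    obtain ⟨l, hlk, hl⟩ := hall
    exact exists_not_hasFiniteDelay_of_ne hαβ hpos hK hlk hik hl (hk l) (hk i)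

theorem theorem3 {X : Type*} [Fintype X] (hX : 2 ≤ Fintype.card X)
    {m : ℕ} (hm : 1 ≤ m) (L : Fin m → ℕ) (hL : (UDCodes X L).Nonempty) :
    FDCodes X L = UDCodes X L ↔
      (m ≤ 2 ∨ ∃ a b : ℕ, a ∣ b ∧
        (List.ofFn L).Perm (List.replicate (m - 1) a ++ [b])) := by
  simp only [ofFn_perm_replicate_append_iff]
  constructor
  · intro heq
    by_contra! hcon
    obtain ⟨hm3, hcon⟩ := hcon
    obtain ⟨C, hC, hdelay⟩ := exists_mem_UDCodes_not_hasFiniteDelay hX hm3 hL (by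
      rintro ⟨a, k, hdvd, h⟩
      obtain ⟨i, hi, hne⟩ := hcon a (L k) hdvd k rfl
      exact hne (h i hi))
    rw [← heq] at hC
    exact hdelay hC.2
  · intro h
    refine Set.Subset.antisymm (fun C hC => hC.1) fun C hC => ⟨hC, ?_⟩
    rcases h with h | ⟨a, b, hdvd, k, rfl, h⟩
    · exact hC.1.hasFiniteDelay_of_le_two h
    · exact hC.1.hasFiniteDelay_of_dvd (fun i hi => (hC.2 i).trans (h i hi))
        ((hC.2 k).symm ▸ hdvd)
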